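/- The Random Apollonian Network $(G_t)_{t\ge 0}$ is the following random sequence of plane graphs. $G_0$ is a triangle on the vertices $1,2,3$ embedded in the plane. For $t\ge 1$, the graph $G_t$ is obtained from $G_{t-1}$ by choosing one of its $2t-1$ bounded (triangular) faces uniformly at random, given the past, inserting the new vertex $t+3$ inside that face, and joining it by edges to the three vertices of that face. Let $k$ be a fixed positive integer and let $\Delta_1\ge\Delta_2\ge\cdots\ge\Delta_k$ be the $k$ highest degrees (counted with multiplicity) of $G_t$. Let $f:\mathbb{N}\to\mathbb{R}$ be any function with $f(t)\to+\infty$ as $t\to+\infty$. Then, with probability tending to $1$ as $t\to+\infty$, $$\frac{t^{1/2}}{f(t)}\le \Delta_1\le t^{1/2} f(t)$$ and, for all $i=2,\dots,k$, $$\frac{t^{1/2}}{f(t)}\le \Delta_i\le \Delta_{i-1}-\frac{t^{1/2}}{f(t)} .$$ -/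

import Mathlib

open Filter Topology

/-- A plane graph with vertices `1, …, order`, all of whose bounded faces are triangles.
`faces` lists the bounded faces by their corners; each bounded face is recorded by exactly one
ordered triple. -/
structure PlaneNetwork where
  order : ℕ
  graph : SimpleGraph ℕ
  faces : Finset (ℕ × ℕ × ℕ)
  faces_nonempty : faces.Nonempty

namespace PlaneNetwork

/-- Every set of networks is an event. -/
instance : MeasurableSpace PlaneNetwork := ⊤

/-- The triangle `(1, 2, 3)`, with its interior as its only bounded face. -/
def triangle : PlaneNetwork where
  order := 3
  graph := SimpleGraph.fromEdgeSet {s(1, 2), s(1, 3), s(2, 3)}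
  faces := {(1, 2, 3)}
  faces_nonempty := Finset.singleton_nonempty _

/-- Insert the next vertex `v` inside the face `F = (i, j, k)` and join it to `i`, `j` and `k`:
the face `F` is subdivided into the three faces `(i, j, v)`, `(i, k, v)`, `(j, k, v)`. -/
def subdivide (N : PlaneNetwork) (F : ℕ × ℕ × ℕ) : PlaneNetwork where
  order := N.order + 1
  graph := N.graph ⊔ SimpleGraph.fromEdgeSet
    {s(F.1, N.order + 1), s(F.2.1, N.order + 1), s(F.2.2, N.order + 1)}
  faces := {(F.1, F.2.1, N.order + 1), (F.1, F.2.2, N.order + 1), (F.2.1, F.2.2, N.order + 1)} ∪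
    N.faces.erase F
  faces_nonempty := by simp

/-- The degree of the vertex `v`. -/
noncomputable def degree (N : PlaneNetwork) (v : ℕ) : ℕ :=
  (N.graph.neighborSet v).ncard

/-- The degrees of the vertices `1, …, order`, with multiplicity, in non-increasing order. -/
noncomputable def degreeList (N : PlaneNetwork) : List ℕ :=
  ((Finset.Icc 1 N.order).val.map N.degree).sort (· ≥ ·)

/-- The `i`-th highest degree `Δ_i`, for `1 ≤ i ≤ order`. -/
noncomputable def highestDegree (N : PlaneNetwork) (i : ℕ) : ℕ :=
  N.degreeList.getD (i - 1) 0

end PlaneNetwork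

/-- The law of the Random Apollonian Network `G_t`: start from the triangle and, at each step,
subdivide a uniformly random bounded face of the current network. -/
noncomputable def randomApollonianNetwork : ℕ → PMF PlaneNetwork
  | 0 => PMF.pure PlaneNetwork.triangle
  | t + 1 => (randomApollonianNetwork t).bind fun N =>
      (PMF.uniformOfFinset N.faces N.faces_nonempty).map N.subdivide

/-! A vertex lying on w of the 2t+1 bounded faces gains a face, and an edge, exactly when one of
those w faces is chosen. Its degree is its face count, plus 1 for the corners 1, 2, 3 of the outer
face. Degrees are thus Pólya urns growing like √t.

Upper bounds: the mean of the fourth rising factorial of a face count is multiplied by (2t+5)/(2t+1)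
at each step, hence is O((t/v)²). Markov's inequality and a sum over v bound the probability that
some v > K has degree at least x by O(t²/(x⁴(K+1))) (`toMeasureReal_exists_le_degree_le`).

Lower bounds and gaps: the number of faces shared by u and v is constant once both exist. The pair
of face counts is therefore a simple Markov chain, whose point probabilities are O(1/t)
(`faceCountsProb_le`, `exists_toMeasureReal_degree_eq_le`). Summing over the O(√t · δ√t) relevant
pairs of values shows that deg u is rarely within δ√t of a prescribed function of deg v
(`exists_toMeasureReal_abs_degree_sub_le`). The zero function gives lower bounds for degrees and the
identity gives gaps.

To conclude, ε is chosen so that vertices 1, …, k likely have degree above ε√t, then K so that no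
later vertex reaches ε√t, then δ so that the degrees of vertices 1, …, K are δ√t apart. The k
highest degrees then belong to the first K vertices and are separated (`highestDegree_separated`),
and √t/f(t) is eventually below both ε√t and δ√t. -/

open scoped ENNReal

/-! ### Expectations under discrete laws -/

/-- The expectation of a nonnegative function with respect to a discrete law. -/
noncomputable def PMF.expect {α : Type*} (p : PMF α) (φ : α → ℝ≥0∞) : ℝ≥0∞ := ∑' a, p a * φ a

namespace PMF

variable {α β : Type*}

lemma expect_pure (a : α) (φ : α → ℝ≥0∞) : (PMF.pure a).expect φ = φ a := by
  unfold expect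
  rw [tsum_eq_single a]
  · simp
  · intro b hb
    simp [PMF.pure_apply, hb]

lemma expect_bind (p : PMF α) (g : α → PMF β) (φ : β → ℝ≥0∞) :
    (p.bind g).expect φ = p.expect fun a => (g a).expect φ := by
  unfold expect
  simp only [PMF.bind_apply, ← ENNReal.tsum_mul_right, ← ENNReal.tsum_mul_left]
  rw [ENNReal.tsum_comm]
  simp only [mul_assoc]

lemma expect_map (p : PMF α) (g : α → β) (φ : β → ℝ≥0∞) :
    (p.map g).expect φ = p.expect fun a => φ (g a) := by
  simp only [PMF.map, expect_bind, Function.comp_apply, expect_pure]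

lemma expect_uniformOfFinset (s : Finset α) (hs : s.Nonempty) (φ : α → ℝ≥0∞) :
    (PMF.uniformOfFinset s hs).expect φ = (s.card : ℝ≥0∞)⁻¹ * ∑ a ∈ s, φ a := by
  unfold expect
  rw [tsum_eq_sum (s := s), Finset.mul_sum]
  · exact Finset.sum_congr rfl fun a ha => by simp [ha]
  · intro a ha
    simp [ha]

lemma expect_mono (p : PMF α) {φ ψ : α → ℝ≥0∞} (h : ∀ a ∈ p.support, φ a ≤ ψ a) :
    p.expect φ ≤ p.expect ψ := by
  refine ENNReal.tsum_le_tsum fun a => ?_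
  by_cases ha : a ∈ p.support
  · gcongr
    exact h a ha
  · simp [(p.apply_eq_zero_iff a).2 ha]

lemma expect_congr (p : PMF α) {φ ψ : α → ℝ≥0∞} (h : ∀ a ∈ p.support, φ a = ψ a) :
    p.expect φ = p.expect ψ :=
  le_antisymm (p.expect_mono fun a ha => (h a ha).le) (p.expect_mono fun a ha => (h a ha).ge)

lemma expect_const_mul (p : PMF α) (c : ℝ≥0∞) (φ : α → ℝ≥0∞) :
    (p.expect fun a => c * φ a) = c * p.expect φ := by
  unfold expect
  rw [← ENNReal.tsum_mul_left]
  exact tsum_congr fun a => mul_left_comm _ _ _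

lemma expect_add (p : PMF α) (φ ψ : α → ℝ≥0∞) :
    (p.expect fun a => φ a + ψ a) = p.expect φ + p.expect ψ := by
  simp only [expect, mul_add, ENNReal.tsum_add]

lemma expect_one (p : PMF α) : (p.expect fun _ => 1) = 1 := by
  simp [expect, p.tsum_coe]

lemma toMeasure_eq_expect [MeasurableSpace α] [DiscreteMeasurableSpace α] (p : PMF α) (P : α → Prop)
    [DecidablePred P] :
    p.toMeasure {a | P a} = p.expect fun a => if P a then 1 else 0 := by
  rw [PMF.toMeasure_apply _ MeasurableSet.of_discrete]
  refine tsum_congr fun a => ?_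
  simp [Set.indicator_apply]

end PMF

/-! ### Face counts and degrees under one insertion -/

namespace PlaneNetwork

instance : DiscreteMeasurableSpace PlaneNetwork := ⟨fun _ => trivial⟩

/-- `v` is one of the three corners of the face `F`. -/
def HasCorner (F : ℕ × ℕ × ℕ) (v : ℕ) : Prop := v = F.1 ∨ v = F.2.1 ∨ v = F.2.2

instance (F : ℕ × ℕ × ℕ) (v : ℕ) : Decidable (HasCorner F v) :=
  inferInstanceAs (Decidable (_ ∨ _ ∨ _))

/-- The number of bounded faces at the vertex `v`. -/
def faceCount (N : PlaneNetwork) (v : ℕ) : ℕ := (N.faces.filter fun F => HasCorner F v).card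

/-- The number of bounded faces that have both `u` and `v` as corners. -/
def commonFaceCount (N : PlaneNetwork) (u v : ℕ) : ℕ :=
  (N.faces.filter fun F => HasCorner F u ∧ HasCorner F v).card

/-- The invariants of the networks that are reached after `t` insertions. -/
structure IsApollonian (t : ℕ) (N : PlaneNetwork) : Prop where
  order_eq : N.order = t + 3
  card_faces : N.faces.card = 2 * t + 1
  faces_lt : ∀ F ∈ N.faces, 1 ≤ F.1 ∧ F.1 < F.2.1 ∧ F.2.1 < F.2.2 ∧ F.2.2 ≤ N.order
  adj_mem : ∀ a b, N.graph.Adj a b → 1 ≤ a ∧ a ≤ N.order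
  degree_eq : ∀ v, 1 ≤ v → v ≤ N.order → N.degree v = N.faceCount v + if v ≤ 3 then 1 else 0
  faceCount_pos : ∀ v, 1 ≤ v → v ≤ N.order → 1 ≤ N.faceCount v
  two_le_faceCount : 1 ≤ t → ∀ v, 1 ≤ v → v ≤ N.order → 2 ≤ N.faceCount v

variable {N : PlaneNetwork} {F : ℕ × ℕ × ℕ} {t : ℕ}

/-- The new label exceeds every old one, so the three added faces are not old faces; they are
distinct because corners increase strictly. The face-count updates below are instances for
particular `P`. -/
lemma card_filter_subdivide (hN : IsApollonian t N) (hF : F ∈ N.faces)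
    (P : ℕ × ℕ × ℕ → Prop) [DecidablePred P] :
    ((N.subdivide F).faces.filter P).card + (if P F then 1 else 0) =
      (N.faces.filter P).card + (if P (F.1, F.2.1, N.order + 1) then 1 else 0) +
        (if P (F.1, F.2.2, N.order + 1) then 1 else 0) +
        (if P (F.2.1, F.2.2, N.order + 1) then 1 else 0) := by
  obtain ⟨h1, h2, h3, h4⟩ := hN.faces_lt F hF
  have hnew : ∀ a b, (a, b, N.order + 1) ∉ N.faces := fun a b h => by
    have := (hN.faces_lt _ h).2.2.2
    simp at this
  simp only [Finset.card_filter, subdivide]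
  rw [← Finset.sum_erase_add _ _ hF, Finset.sum_union, Finset.sum_insert, Finset.sum_insert,
    Finset.sum_singleton]
  · ring
  · simp [Prod.ext_iff]; omega
  · simp [Prod.ext_iff]; omega
  · rw [Finset.disjoint_left]
    intro G hG hG'
    have hG' := Finset.mem_of_mem_erase hG'
    simp only [Finset.mem_insert, Finset.mem_singleton] at hG
    rcases hG with rfl | rfl | rfl <;> exact hnew _ _ hG'

lemma card_faces_subdivide (hN : IsApollonian t N) (hF : F ∈ N.faces) :
    (N.subdivide F).faces.card = N.faces.card + 2 := by
  have := card_filter_subdivide hN hF (fun _ => True)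
  simp at this
  omega

lemma faceCount_subdivide (hN : IsApollonian t N) (hF : F ∈ N.faces) {v : ℕ} (hv : v ≤ N.order) :
    (N.subdivide F).faceCount v = N.faceCount v + if HasCorner F v then 1 else 0 := by
  have := card_filter_subdivide hN hF (fun G => HasCorner G v)
  obtain ⟨h1, h2, h3, h4⟩ := hN.faces_lt F hF
  beta_reduce at this
  change _ + _ = N.faceCount v + _ + _ + _ at this
  change Finset.card _ = _
  split_ifs at this ⊢ <;> simp only [HasCorner] at * <;> omega

lemma faceCount_subdivide_self (hN : IsApollonian t N) (hF : F ∈ N.faces) :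
    (N.subdivide F).faceCount (N.order + 1) = 3 := by
  have := card_filter_subdivide hN hF (fun G => HasCorner G (N.order + 1))
  have h0 : N.faces.filter (fun G => HasCorner G (N.order + 1)) = ∅ := by
    refine Finset.filter_eq_empty_iff.2 fun G hG h => ?_
    have := hN.faces_lt G hG
    unfold HasCorner at h
    omega
  have hF' : ¬ HasCorner F (N.order + 1) := Finset.filter_eq_empty_iff.1 h0 hF
  rw [h0] at this
  rw [if_neg hF', if_pos (by simp [HasCorner]), if_pos (by simp [HasCorner]),
    if_pos (by simp [HasCorner])] at this
  simpa [faceCount] using this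

/-- If the chosen face contains both vertices, it is lost but exactly one of its three parts
contains both; otherwise nothing is lost or gained. This conservation law makes the joint law of two
degrees tractable. -/
lemma commonFaceCount_subdivide (hN : IsApollonian t N) (hF : F ∈ N.faces) {u v : ℕ} (huv : u ≠ v)
    (hu : u ≤ N.order) (hv : v ≤ N.order) :
    (N.subdivide F).commonFaceCount u v = N.commonFaceCount u v := by
  have := card_filter_subdivide hN hF (fun G => HasCorner G u ∧ HasCorner G v)
  obtain ⟨h1, h2, h3, h4⟩ := hN.faces_lt F hF
  beta_reduce at this
  change (N.subdivide F).commonFaceCount u v + _ = N.commonFaceCount u v + _ + _ + _ at this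
  split_ifs at this <;> simp only [HasCorner] at * <;> omega

lemma IsApollonian.finite_neighborSet (hN : IsApollonian t N) (v : ℕ) :
    (N.graph.neighborSet v).Finite :=
  (Set.finite_Iic N.order).subset fun _ hw => (hN.adj_mem _ _ hw.symm).2

lemma IsApollonian.degree_eq_zero (hN : IsApollonian t N) {v : ℕ} (hv : N.order < v) :
    N.degree v = 0 := by
  have : N.graph.neighborSet v = ∅ := by
    ext w
    simp only [SimpleGraph.mem_neighborSet, Set.mem_empty_iff_false, iff_false]
    intro h
    have := (hN.adj_mem _ _ h).2
    omega
  simp [degree, this]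

lemma degree_subdivide (hN : IsApollonian t N) (hF : F ∈ N.faces) {v : ℕ} (hv : v ≤ N.order) :
    (N.subdivide F).degree v = N.degree v + if HasCorner F v then 1 else 0 := by
  obtain ⟨h1, h2, h3, h4⟩ := hN.faces_lt F hF
  unfold degree
  split_ifs with h
  · have : (N.subdivide F).graph.neighborSet v = insert (N.order + 1) (N.graph.neighborSet v) := by
      ext w
      simp only [subdivide, SimpleGraph.mem_neighborSet, SimpleGraph.sup_adj,
        SimpleGraph.fromEdgeSet_adj, Set.mem_insert_iff, Set.mem_singleton_iff, Sym2.eq_iff]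
      unfold HasCorner at h
      constructor
      · rintro (h | h)
        · exact Or.inr h
        · left; omega
      · rintro (h | h)
        · right; omega
        · exact Or.inl h
    rw [this, Set.ncard_insert_of_notMem _ (hN.finite_neighborSet v)]
    intro hw
    have := (hN.adj_mem _ _ (SimpleGraph.Adj.symm hw)).2
    omega
  · have : (N.subdivide F).graph.neighborSet v = N.graph.neighborSet v := by
      ext w
      simp only [subdivide, SimpleGraph.mem_neighborSet, SimpleGraph.sup_adj,
        SimpleGraph.fromEdgeSet_adj, Set.mem_insert_iff, Set.mem_singleton_iff, Sym2.eq_iff]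
      unfold HasCorner at h
      constructor
      · rintro (h | h)
        · exact h
        · omega
      · exact Or.inl
    rw [this, add_zero]

lemma degree_subdivide_self (hN : IsApollonian t N) (hF : F ∈ N.faces) :
    (N.subdivide F).degree (N.order + 1) = 3 := by
  obtain ⟨h1, h2, h3, h4⟩ := hN.faces_lt F hF
  have : (N.subdivide F).graph.neighborSet (N.order + 1) =
      (({F.1, F.2.1, F.2.2} : Finset ℕ) : Set ℕ) := by
    ext w
    simp only [subdivide, SimpleGraph.mem_neighborSet, SimpleGraph.sup_adj,
      SimpleGraph.fromEdgeSet_adj, Set.mem_insert_iff, Set.mem_singleton_iff, Sym2.eq_iff,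
      Finset.coe_insert, Finset.coe_singleton]
    constructor
    · rintro (h | h)
      · have := (hN.adj_mem _ _ h).2
        omega
      · omega
    · rintro (rfl | rfl | rfl) <;> right <;> simp <;> omega
  rw [degree, this, Set.ncard_coe_finset]
  exact Finset.card_eq_three.2 ⟨_, _, _, by omega, by omega, by omega, rfl⟩

lemma isApollonian_triangle : IsApollonian 0 triangle where
  order_eq := rfl
  card_faces := rfl
  faces_lt := by simp [triangle]
  adj_mem a b h := by
    simp only [triangle, SimpleGraph.fromEdgeSet_adj, Set.mem_insert_iff, Set.mem_singleton_iff,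
      Sym2.eq_iff] at h ⊢
    omega
  degree_eq v h1 h3 := by
    have key : triangle.graph.neighborSet v = ((({1, 2, 3} : Finset ℕ).erase v : Finset ℕ) : Set ℕ) := by
      ext w
      simp only [triangle, SimpleGraph.mem_neighborSet, SimpleGraph.fromEdgeSet_adj,
        Set.mem_insert_iff, Set.mem_singleton_iff, Sym2.eq_iff, Finset.coe_erase,
        Finset.coe_insert, Finset.coe_singleton, Set.mem_sdiff] at h3 ⊢
      omega
    rw [degree, key, Set.ncard_coe_finset]
    change v ≤ 3 at h3
    interval_cases v <;> rfl
  faceCount_pos v h1 h3 := by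
    change v ≤ 3 at h3
    interval_cases v <;> decide
  two_le_faceCount h := by omega

lemma IsApollonian.subdivide (hN : IsApollonian t N) (hF : F ∈ N.faces) :
    IsApollonian (t + 1) (N.subdivide F) := by
  obtain ⟨h1, h2, h3, h4⟩ := hN.faces_lt F hF
  have hord : (N.subdivide F).order = N.order + 1 := rfl
  have ho := hN.order_eq
  have two : ∀ v, 1 ≤ v → v ≤ (N.subdivide F).order → 2 ≤ (N.subdivide F).faceCount v := by
    intro v hv hv'
    rcases hv'.lt_or_eq with h | rfl
    · rw [hord] at h
      have h1 := hN.faceCount_pos v hv (by omega)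
      rw [faceCount_subdivide hN hF (by omega)]
      -- The triangle has a single face, so the first insertion raises the counts of all its corners
      -- from 1 to 2.
      rcases Nat.eq_zero_or_pos t with rfl | ht
      · have hc := hN.card_faces
        have hsub : (N.faces.filter fun F => HasCorner F v) = N.faces :=
          Finset.eq_of_subset_of_card_le (Finset.filter_subset _ _) (by
            unfold faceCount at h1; omega)
        have : HasCorner F v := (Finset.filter_eq_self.1 hsub) F hF
        simp only [this, if_true]
        omega
      · have := hN.two_le_faceCount ht v hv (by omega)
        omega
    · rw [hord, faceCount_subdivide_self hN hF]
      omega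
  refine ⟨by omega, ?_, ?_, ?_, ?_, ?_, fun _ => two⟩
  · rw [card_faces_subdivide hN hF, hN.card_faces]; ring
  · intro G hG
    simp only [PlaneNetwork.subdivide, Finset.mem_union, Finset.mem_insert, Finset.mem_singleton,
      Finset.mem_erase] at hG
    rw [hord]
    rcases hG with (rfl | rfl | rfl) | ⟨-, hG⟩
    · dsimp only; omega
    · dsimp only; omega
    · dsimp only; omega
    · have := hN.faces_lt G hG
      omega
  · intro a b h
    rw [hord]
    simp only [PlaneNetwork.subdivide, SimpleGraph.sup_adj,
        SimpleGraph.fromEdgeSet_adj, Set.mem_insert_iff, Set.mem_singleton_iff, Sym2.eq_iff] at h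
    rcases h with h | h
    · have := hN.adj_mem a b h
      omega
    · omega
  · intro v hv hv'
    rcases hv'.lt_or_eq with h | rfl
    · rw [hord] at h
      rw [degree_subdivide hN hF (by omega), faceCount_subdivide hN hF (by omega),
        hN.degree_eq v hv (by omega)]
      ring
    · rw [hord, degree_subdivide_self hN hF, faceCount_subdivide_self hN hF, if_neg (by omega)]
  · intro v hv hv'
    exact le_trans (by omega) (two v hv hv')

end PlaneNetwork

/-! ### Reachable networks and one-step expectations -/

open PlaneNetwork

lemma mem_support_randomApollonianNetwork_succ {t : ℕ} {N : PlaneNetwork}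
    (h : N ∈ (randomApollonianNetwork (t + 1)).support) :
    ∃ M ∈ (randomApollonianNetwork t).support, ∃ F ∈ M.faces, N = M.subdivide F := by
  simp only [randomApollonianNetwork, PMF.support_bind, PMF.support_map,
    PMF.support_uniformOfFinset, Set.mem_iUnion, Set.mem_image, Finset.mem_coe] at h
  obtain ⟨M, hM, F, hF, rfl⟩ := h
  exact ⟨M, hM, F, hF, rfl⟩

lemma isApollonian_of_mem_support {t : ℕ} :
    ∀ {N : PlaneNetwork}, N ∈ (randomApollonianNetwork t).support → IsApollonian t N := by
  induction t with
  | zero =>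
    intro N h
    simp only [randomApollonianNetwork, PMF.support_pure, Set.mem_singleton_iff] at h
    exact h ▸ isApollonian_triangle
  | succ t ih =>
    intro N h
    obtain ⟨M, hM, F, hF, rfl⟩ := mem_support_randomApollonianNetwork_succ h
    exact (ih hM).subdivide hF

lemma mul_expect_randomApollonianNetwork_succ (t : ℕ) (φ : PlaneNetwork → ℝ≥0∞) :
    ((2 * t + 1 : ℕ) : ℝ≥0∞) * (randomApollonianNetwork (t + 1)).expect φ =
      (randomApollonianNetwork t).expect fun N => ∑ F ∈ N.faces, φ (N.subdivide F) := by
  simp only [randomApollonianNetwork, PMF.expect_bind, PMF.expect_map,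
    PMF.expect_uniformOfFinset]
  rw [← PMF.expect_const_mul]
  refine PMF.expect_congr _ fun N hN => ?_
  rw [(isApollonian_of_mem_support hN).card_faces, ← mul_assoc,
    ENNReal.mul_inv_cancel (by simp) (ENNReal.natCast_ne_top _), one_mul]

lemma toMeasureReal_mono {t : ℕ} {P Q : PlaneNetwork → Prop}
    (h : ∀ N, IsApollonian t N → P N → Q N) :
    (randomApollonianNetwork t).toMeasure.real {N | P N} ≤
      (randomApollonianNetwork t).toMeasure.real {N | Q N} := by
  refine ENNReal.toReal_mono (MeasureTheory.measure_ne_top _ _) ?_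
  exact PMF.toMeasure_mono _ MeasurableSet.of_discrete
    fun N hN => h N (isApollonian_of_mem_support hN.2) hN.1

/-! ### Fourth moments and upper tails of degrees -/

namespace PlaneNetwork

variable {N : PlaneNetwork} {t : ℕ}

lemma sum_faces_ite (v : ℕ) (x y : ℕ) :
    (∑ F ∈ N.faces, if HasCorner F v then x else y) =
      N.faceCount v * x + (N.faces.card - N.faceCount v) * y := by
  rw [Finset.sum_ite, Finset.sum_const, Finset.sum_const, smul_eq_mul, smul_eq_mul, faceCount,
    ← Finset.card_filter_add_card_filter_not (s := N.faces) (fun F => HasCorner F v)]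
  simp

lemma faceCount_le_card (v : ℕ) : N.faceCount v ≤ N.faces.card := Finset.card_filter_le _ _

/-- The fourth rising power of the number of faces at `v`. -/
def risingMoment (v : ℕ) (N : PlaneNetwork) : ℕ :=
  N.faceCount v * (N.faceCount v + 1) * (N.faceCount v + 2) * (N.faceCount v + 3)

/-- With n = 2t+1 faces, w choices give (w+1)⋯(w+4) and n−w choices leave w⋯(w+3); the sum factors
as (n+4)·w⋯(w+3). The fourth moment leads to tails of order v⁻², which can be summed over all
vertices. -/
lemma sum_risingMoment_subdivide (hN : IsApollonian t N) {v : ℕ} (hv : v ≤ N.order) :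
    ∑ F ∈ N.faces, risingMoment v (N.subdivide F) = (2 * t + 5) * risingMoment v N := by
  set w := N.faceCount v with hw
  have : ∀ F ∈ N.faces, risingMoment v (N.subdivide F) = if HasCorner F v then
      (w + 1) * (w + 2) * (w + 3) * (w + 4) else w * (w + 1) * (w + 2) * (w + 3) := by
    intro F hF
    rw [risingMoment, faceCount_subdivide hN hF hv, ← hw]
    split_ifs <;> ring
  rw [Finset.sum_congr rfl this, sum_faces_ite, ← hw, risingMoment, ← hw]
  have hle : w ≤ N.faces.card := faceCount_le_card v
  obtain ⟨m, hm⟩ := Nat.exists_eq_add_of_le hle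
  have hc := hN.card_faces
  rw [hm, Nat.add_sub_cancel_left]
  have : 2 * t + 5 = w + m + 4 := by omega
  rw [this]
  ring

end PlaneNetwork

/-- Truncated subtraction makes `v - 3` the birth time of every vertex, including 1, 2, 3 at time 0.
-/
lemma faceCount_le_three_of_birth {t v : ℕ} (hv : v - 3 = t) {N : PlaneNetwork} (hv1 : v ≤ t + 3)
    (hN : N ∈ (randomApollonianNetwork t).support) : N.faceCount v ≤ 3 := by
  cases t with
  | zero =>
    have := (isApollonian_of_mem_support hN).card_faces
    have h := faceCount_le_card (N := N) v
    omega
  | succ t =>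
    obtain ⟨M, hM, F, hF, rfl⟩ := mem_support_randomApollonianNetwork_succ hN
    have hM := isApollonian_of_mem_support hM
    have : v = M.order + 1 := by rw [hM.order_eq]; omega
    rw [this, faceCount_subdivide_self hM hF]

/-- The growth factor (2t+5)/(2t+1) is at most ((2t+3)/(2t+1))², whose product telescopes. The
initial value is at most 3·4·5·6 = 360. -/
lemma expect_risingMoment_le (v m : ℕ) :
    (((2 * (v - 3) + 1) ^ 2 : ℕ) : ℝ≥0∞) *
      (randomApollonianNetwork (v - 3 + m)).expect (fun N => (risingMoment v N : ℝ≥0∞)) ≤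
      ((360 * (2 * (v - 3 + m) + 1) ^ 2 : ℕ) : ℝ≥0∞) := by
  induction m with
  | zero =>
    rw [add_zero, mul_comm 360 _, Nat.cast_mul]
    gcongr
    calc _ ≤ (randomApollonianNetwork (v - 3)).expect (fun _ => (360 : ℕ) * 1) := by
          refine PMF.expect_mono _ fun N hN => ?_
          rw [mul_one]
          have h3 := faceCount_le_three_of_birth rfl (by omega) hN
          have : risingMoment v N ≤ 3 * (3 + 1) * (3 + 2) * (3 + 3) := by
            unfold risingMoment
            gcongr
          exact_mod_cast this
      _ = _ := by rw [PMF.expect_const_mul, PMF.expect_one, mul_one]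
  | succ m ih =>
    set t := v - 3 + m with ht
    have hstep := mul_expect_randomApollonianNetwork_succ t (fun N => (risingMoment v N : ℝ≥0∞))
    have : ((randomApollonianNetwork t).expect fun N =>
        ∑ F ∈ N.faces, (risingMoment v (N.subdivide F) : ℝ≥0∞)) =
        ((2 * t + 5 : ℕ) : ℝ≥0∞) *
          (randomApollonianNetwork t).expect fun N => (risingMoment v N : ℝ≥0∞) := by
      rw [← PMF.expect_const_mul]
      refine PMF.expect_congr _ fun N hN => ?_
      have hN := isApollonian_of_mem_support hN
      have := sum_risingMoment_subdivide hN (v := v) (by rw [hN.order_eq]; omega)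
      exact_mod_cast this
    rw [this] at hstep
    have hne : ((2 * t + 1 : ℕ) : ℝ≥0∞) ≠ 0 := by simp
    rw [← ENNReal.mul_le_mul_iff_right hne (ENNReal.natCast_ne_top _), mul_left_comm,
      show v - 3 + (m + 1) = t + 1 by omega, hstep, mul_left_comm]
    calc _ ≤ ((2 * t + 5 : ℕ) : ℝ≥0∞) * ((360 * (2 * t + 1) ^ 2 : ℕ) : ℝ≥0∞) := by gcongr
      _ ≤ _ := by
        rw [← Nat.cast_mul, ← Nat.cast_mul]
        refine Nat.cast_le.2 ?_
        nlinarith [Nat.zero_le t]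

/-- Markov's inequality for the fourth power. The degree is at most twice the face count, which
costs 16; replacing 2(v−3)+1 by v/3 and 2t+1 by 3t costs 9 each, and 466560 = 9·16·360·9. -/
lemma toMeasureReal_le_degree_le {t v : ℕ} (ht : 1 ≤ t) (hv : 1 ≤ v) {x : ℝ} (hx : 0 < x) :
    (randomApollonianNetwork t).toMeasure.real {N | x ≤ N.degree v} ≤
      466560 * (t : ℝ) ^ 2 / x ^ 4 * ((v : ℝ) ^ 2)⁻¹ := by
  by_cases hvt : v ≤ t + 3
  swap
  · have : (randomApollonianNetwork t).toMeasure.real {N | x ≤ N.degree v} ≤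
        (randomApollonianNetwork t).toMeasure.real {N | False} := by
      refine toMeasureReal_mono fun N hN h => ?_
      rw [hN.degree_eq_zero (by rw [hN.order_eq]; omega)] at h
      norm_num at h
      linarith
    refine this.trans ?_
    simp only [Set.ofPred_false, MeasureTheory.measureReal_empty]
    positivity
  classical
  obtain ⟨m, hm⟩ := Nat.exists_eq_add_of_le (show v - 3 ≤ t by omega)
  have hE := expect_risingMoment_le v m
  rw [← hm] at hE
  set p := (randomApollonianNetwork t).toMeasure {N | x ≤ N.degree v} with hp
  have hM : ENNReal.ofReal (x ^ 4) * p ≤ ((16 : ℕ) : ℝ≥0∞) *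
      (randomApollonianNetwork t).expect (fun N => (risingMoment v N : ℝ≥0∞)) := by
    rw [hp, PMF.toMeasure_eq_expect, ← PMF.expect_const_mul, ← PMF.expect_const_mul]
    refine PMF.expect_mono _ fun N hN => ?_
    have hN := isApollonian_of_mem_support hN
    split_ifs with h
    · have hd := hN.degree_eq v hv (by rw [hN.order_eq]; omega)
      have h1 := hN.faceCount_pos v hv (by rw [hN.order_eq]; omega)
      have hd2 : N.degree v ≤ 2 * N.faceCount v := by
        split_ifs at hd <;> omega
      have h4 : N.degree v ^ 4 ≤ 16 * risingMoment v N := by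
        calc N.degree v ^ 4 ≤ (2 * N.faceCount v) ^ 4 := by gcongr
          _ = 16 * (N.faceCount v * N.faceCount v * N.faceCount v * N.faceCount v) := by ring
          _ ≤ _ := by
            unfold risingMoment
            gcongr <;> omega
      rw [mul_one, ← Nat.cast_mul, ← ENNReal.ofReal_natCast]
      refine ENNReal.ofReal_le_ofReal ?_
      calc x ^ 4 ≤ (N.degree v : ℝ) ^ 4 := by gcongr
        _ ≤ _ := by exact_mod_cast h4
    · simp
  have key : (((2 * (v - 3) + 1) ^ 2 : ℕ) : ℝ≥0∞) * (ENNReal.ofReal (x ^ 4) * p) ≤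
      ((16 * (360 * (2 * t + 1) ^ 2) : ℕ) : ℝ≥0∞) := by
    calc _ ≤ _ := mul_le_mul_right hM _
      _ = _ := mul_left_comm _ _ _
      _ ≤ _ := by
        rw [Nat.cast_mul]
        exact mul_le_mul_right hE _
  have hr := ENNReal.toReal_mono (ENNReal.natCast_ne_top _) key
  rw [ENNReal.toReal_mul, ENNReal.toReal_mul, ENNReal.toReal_natCast, ENNReal.toReal_natCast,
    ENNReal.toReal_ofReal (by positivity)] at hr
  have hv3 : (v : ℝ) ≤ 3 * ((2 * (v - 3) + 1 : ℕ) : ℝ) := by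
    have : v ≤ 3 * (2 * (v - 3) + 1) := by omega
    exact_mod_cast this
  have ht3 : ((2 * t + 1 : ℕ) : ℝ) ≤ 3 * t := by
    have : 2 * t + 1 ≤ 3 * t := by omega
    exact_mod_cast this
  change p.toReal ≤ _
  have hv0 : (0 : ℝ) < v := by exact_mod_cast hv
  rw [div_mul_eq_mul_div, ← div_eq_mul_inv, le_div_iff₀ (by positivity),
    le_div_iff₀ (by positivity)]
  have h1 : (v : ℝ) ^ 2 ≤ 9 * ((2 * (v - 3) + 1 : ℕ) : ℝ) ^ 2 := by
    calc (v : ℝ) ^ 2 ≤ (3 * ((2 * (v - 3) + 1 : ℕ) : ℝ)) ^ 2 := by gcongr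
      _ = _ := by ring
  have h2 : ((2 * t + 1 : ℕ) : ℝ) ^ 2 ≤ 9 * (t : ℝ) ^ 2 := by
    calc ((2 * t + 1 : ℕ) : ℝ) ^ 2 ≤ (3 * (t : ℝ)) ^ 2 := by gcongr
      _ = _ := by ring
  have hp0 : 0 ≤ p.toReal := ENNReal.toReal_nonneg
  calc p.toReal * x ^ 4 * (v : ℝ) ^ 2
      ≤ p.toReal * x ^ 4 * (9 * ((2 * (v - 3) + 1 : ℕ) : ℝ) ^ 2) := by gcongr
    _ = 9 * (((2 * (v - 3) + 1 : ℕ) : ℝ) ^ 2 * (x ^ 4 * p.toReal)) := by ring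
    _ ≤ 9 * (16 * (360 * ((2 * t + 1 : ℕ) : ℝ) ^ 2)) := by
      push_cast at hr ⊢
      linarith
    _ ≤ 9 * (16 * (360 * (9 * (t : ℝ) ^ 2))) := by gcongr
    _ = _ := by ring

lemma toMeasureReal_exists_le_degree_le {t : ℕ} (ht : 1 ≤ t) (K : ℕ) {x : ℝ} (hx : 0 < x) :
    (randomApollonianNetwork t).toMeasure.real {N | ∃ v, K < v ∧ x ≤ N.degree v} ≤
      466560 * (t : ℝ) ^ 2 / x ^ 4 * (2 / (K + 1)) := by
  calc _ ≤ (randomApollonianNetwork t).toMeasure.real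
        {N | ∃ v, v ∈ Finset.Ioo K (t + 4) ∧ x ≤ N.degree v} := by
        refine toMeasureReal_mono fun N hN ⟨v, hv, h⟩ => ⟨v, ?_, h⟩
        rw [Finset.mem_Ioo]
        refine ⟨hv, ?_⟩
        by_contra hlt
        rw [hN.degree_eq_zero (by rw [hN.order_eq]; omega)] at h
        norm_num at h
        linarith
    _ = (randomApollonianNetwork t).toMeasure.real
        (⋃ v ∈ Finset.Ioo K (t + 4), {N | x ≤ N.degree v}) := by
        congr 1
        ext N
        simp
    _ ≤ ∑ v ∈ Finset.Ioo K (t + 4),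
        (randomApollonianNetwork t).toMeasure.real {N | x ≤ N.degree v} :=
        MeasureTheory.measureReal_biUnion_finset_le _ _
    _ ≤ ∑ v ∈ Finset.Ioo K (t + 4), 466560 * (t : ℝ) ^ 2 / x ^ 4 * ((v : ℝ) ^ 2)⁻¹ := by
        refine Finset.sum_le_sum fun v hv => toMeasureReal_le_degree_le ht ?_ hx
        rw [Finset.mem_Ioo] at hv
        omega
    _ ≤ _ := by
        rw [← Finset.mul_sum]
        gcongr
        exact sum_Ioo_inv_sq_le _ _

/-! ### Joint point probabilities of two degrees -/

namespace PlaneNetwork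

variable {N : PlaneNetwork} {t : ℕ}

/-- `u` lies on `i` faces, `v` on `j` faces, and `b` faces are common to both. -/
def HasFaceCounts (u v i j b : ℕ) (N : PlaneNetwork) : Prop :=
  N.faceCount u = i ∧ N.faceCount v = j ∧ N.commonFaceCount u v = b

instance (u v i j b : ℕ) (N : PlaneNetwork) : Decidable (HasFaceCounts u v i j b N) :=
  inferInstanceAs (Decidable (_ ∧ _ ∧ _))

lemma card_faces_only_add (u v : ℕ) :
    (N.faces.filter fun F => HasCorner F u ∧ ¬ HasCorner F v).card + N.commonFaceCount u v =
      N.faceCount u := by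
  rw [add_comm, commonFaceCount, faceCount,
    ← Finset.card_filter_add_card_filter_not (s := N.faces.filter fun F => HasCorner F u)
      (fun F => HasCorner F v), Finset.filter_filter, Finset.filter_filter]

lemma commonFaceCount_comm (u v : ℕ) : N.commonFaceCount u v = N.commonFaceCount v u := by
  simp only [commonFaceCount, and_comm]

lemma card_faces_neither_add (u v : ℕ) :
    (N.faces.filter fun F => ¬ HasCorner F u ∧ ¬ HasCorner F v).card + N.faceCount u +
      N.faceCount v = N.faces.card + N.commonFaceCount u v := by
  have h1 := Finset.card_filter_add_card_filter_not (s := N.faces) (fun F => HasCorner F u)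
  have h2 := Finset.card_filter_add_card_filter_not
    (s := N.faces.filter fun F => ¬ HasCorner F u) (fun F => HasCorner F v)
  have h3 := card_faces_only_add (N := N) v u
  rw [Finset.filter_filter, Finset.filter_filter] at h2
  simp only [and_comm (a := HasCorner _ v)] at h3
  rw [commonFaceCount_comm] at h3
  change N.faceCount u + _ = _ at h1
  omega

/-- The faces whose subdivision leads to given face counts, sorted by the face counts before. -/
lemma card_faces_hasFaceCounts_subdivide_le (hN : IsApollonian t N) {u v : ℕ} (huv : u ≠ v)
    (hu : u ≤ N.order) (hv : v ≤ N.order) (i j b : ℕ) :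
    (N.faces.filter fun F => HasFaceCounts u v (i + 1) (j + 1) b (N.subdivide F)).card ≤
      (2 * t + 1 + b - (i + j + 2)) * (if HasFaceCounts u v (i + 1) (j + 1) b N then 1 else 0) +
      (i - b) * (if HasFaceCounts u v i (j + 1) b N then 1 else 0) +
      (j - b) * (if HasFaceCounts u v (i + 1) j b N then 1 else 0) +
      b * (if HasFaceCounts u v i j b N then 1 else 0) := by
  have hcard := hN.card_faces
  have hu' := card_faces_only_add (N := N) u v
  have hv' := card_faces_only_add (N := N) v u
  have hn := card_faces_neither_add (N := N) u v
  rw [← commonFaceCount_comm] at hv'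
  have hfilter : (N.faces.filter fun F => HasFaceCounts u v (i + 1) (j + 1) b (N.subdivide F)) =
      N.faces.filter fun F => N.faceCount u + (if HasCorner F u then 1 else 0) = i + 1 ∧
        N.faceCount v + (if HasCorner F v then 1 else 0) = j + 1 ∧ N.commonFaceCount u v = b := by
    refine Finset.filter_congr fun F hF => ?_
    rw [HasFaceCounts, faceCount_subdivide hN hF hu, faceCount_subdivide hN hF hv,
      commonFaceCount_subdivide hN hF huv hu hv]
  rw [hfilter]
  by_cases hb : N.commonFaceCount u v = b
  swap
  · simp [hb]
  have hcommon : (N.faces.filter fun F => HasCorner F u ∧ HasCorner F v).card = b := hb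
  have mono : ∀ Q : ℕ × ℕ × ℕ → Prop, ∀ [DecidablePred Q], (∀ F,
      (N.faceCount u + (if HasCorner F u then 1 else 0) = i + 1 ∧
        N.faceCount v + (if HasCorner F v then 1 else 0) = j + 1 ∧
          N.commonFaceCount u v = b) → Q F) →
      (N.faces.filter fun F => N.faceCount u + (if HasCorner F u then 1 else 0) = i + 1 ∧
        N.faceCount v + (if HasCorner F v then 1 else 0) = j + 1 ∧
          N.commonFaceCount u v = b).card ≤ (N.faces.filter Q).card :=
    fun Q _ h => Finset.card_le_card (Finset.monotone_filter_right _ fun F _ hF => h F hF)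
  unfold HasFaceCounts
  -- The chosen face must contain exactly those of u, v whose count is still one short. This gives
  -- the four types of face: neither, only v, only u, both.
  by_cases hi : N.faceCount u = i + 1
  · by_cases hj : N.faceCount v = j + 1
    · have := mono (fun F => ¬ HasCorner F u ∧ ¬ HasCorner F v) (by
        intro F h
        split_ifs at h <;> simp_all)
      refine this.trans ?_
      simp only [hi, hj, hb, and_self, if_true, mul_one]
      omega
    · by_cases hj' : N.faceCount v = j
      · have := mono (fun F => HasCorner F v ∧ ¬ HasCorner F u) (by
          intro F h
          split_ifs at h <;> simp_all)
        refine this.trans ?_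
        simp only [hi, hj', hb, and_self, if_true, mul_one]
        omega
      · have := mono (fun F => False) (by
          intro F h
          split_ifs at h <;> omega)
        simp only [Finset.filter_false, Finset.card_empty] at this
        omega
  · by_cases hi' : N.faceCount u = i
    · by_cases hj : N.faceCount v = j + 1
      · have := mono (fun F => HasCorner F u ∧ ¬ HasCorner F v) (by
          intro F h
          split_ifs at h <;> simp_all)
        refine this.trans ?_
        simp only [hi', hj, hb, and_self, if_true, mul_one]
        omega
      · by_cases hj' : N.faceCount v = j
        · have := mono (fun F => HasCorner F u ∧ HasCorner F v) (by
            intro F h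
            split_ifs at h <;> simp_all)
          refine this.trans ?_
          simp only [hi', hj', hb, and_self, if_true, mul_one]
          omega
        · have := mono (fun F => False) (by
            intro F h
            split_ifs at h <;> omega)
          simp only [Finset.filter_false, Finset.card_empty] at this
          omega
    · have := mono (fun F => False) (by
        intro F h
        split_ifs at h <;> omega)
      simp only [Finset.filter_false, Finset.card_empty] at this
      omega

/-- The weight in the local bound for the face counts `(i, j, b)` among `n` faces: zero if the
counts are impossible, and smaller if every face has `u` or `v` as a corner. -/
def localWeight (n i j b : ℕ) : ℕ :=
  if b ≤ i ∧ b ≤ j ∧ 2 ≤ i ∧ 2 ≤ j ∧ i + j ≤ n + b then (if i + j = n + b then 1 else 2) else 0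

lemma localWeight_le_two (n i j b : ℕ) : localWeight n i j b ≤ 2 := by
  unfold localWeight
  split_ifs <;> omega

lemma IsApollonian.localWeight_pos (hN : IsApollonian t N) (ht : 1 ≤ t) {u v i j b : ℕ}
    (hu1 : 1 ≤ u) (hv1 : 1 ≤ v) (hu : u ≤ N.order) (hv : v ≤ N.order)
    (h : HasFaceCounts u v i j b N) : 1 ≤ localWeight (2 * t + 1) i j b := by
  obtain ⟨rfl, rfl, rfl⟩ := h
  have hcard := hN.card_faces
  have hu' := card_faces_only_add (N := N) u v
  have hv' := card_faces_only_add (N := N) v u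
  have hn := card_faces_neither_add (N := N) u v
  rw [← commonFaceCount_comm] at hv'
  have := hN.two_le_faceCount ht u hu1 hu
  have := hN.two_le_faceCount ht v hv1 hv
  unfold localWeight
  rw [if_pos (by omega)]
  split_ifs <;> omega

/-- Away from the boundary the coefficients on the left sum to n−2, so the constant weight 2 is
preserved. Near i+j = n+b the subtraction truncates and the sum is too large; the smaller weight 1
there compensates, using b+3 ≤ n. At i+1 = j+1 = b the first coefficient is n−b, which is at most
n−2 because the weight requires counts of at least 2. -/
lemma localWeight_recursion (n i j b : ℕ) (hb : b + 3 ≤ n) :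
    (n + b - (i + j + 2)) * localWeight n (i + 1) (j + 1) b + (i - b) * localWeight n i (j + 1) b +
      (j - b) * localWeight n (i + 1) j b + b * localWeight n i j b ≤
      (n - 2) * localWeight (n + 2) (i + 1) (j + 1) b := by
  unfold localWeight
  split_ifs <;> omega

end PlaneNetwork

/-- The probability that `u`, `v` have the face counts `(i, j, b)` after `t` insertions. -/
noncomputable def faceCountsProb (t u v i j b : ℕ) : ℝ≥0∞ :=
  (randomApollonianNetwork t).expect fun N => if HasFaceCounts u v i j b N then 1 else 0

lemma faceCountsProb_le_one (t u v i j b : ℕ) : faceCountsProb t u v i j b ≤ 1 := by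
  rw [← PMF.expect_one (randomApollonianNetwork t)]
  refine PMF.expect_mono _ fun N _ => ?_
  split_ifs <;> simp

lemma faceCountsProb_eq_zero {t u v i j b : ℕ} (ht : 1 ≤ t) (hu1 : 1 ≤ u) (hv1 : 1 ≤ v)
    (hu : u ≤ t + 3) (hv : v ≤ t + 3) (h : localWeight (2 * t + 1) i j b = 0) :
    faceCountsProb t u v i j b = 0 := by
  rw [faceCountsProb, PMF.expect_congr (ψ := fun _ => 0 * 1), PMF.expect_const_mul, zero_mul]
  intro N hN
  have hN := isApollonian_of_mem_support hN
  rw [if_neg, zero_mul]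
  intro hc
  have := hN.localWeight_pos ht hu1 hv1 (by rwa [hN.order_eq]) (by rwa [hN.order_eq]) hc
  omega

lemma mul_faceCountsProb_succ_le {t u v : ℕ} (huv : u ≠ v) (hu : u ≤ t + 3) (hv : v ≤ t + 3)
    (i j b : ℕ) :
    ((2 * t + 1 : ℕ) : ℝ≥0∞) * faceCountsProb (t + 1) u v (i + 1) (j + 1) b ≤
      ((2 * t + 1 + b - (i + j + 2) : ℕ) : ℝ≥0∞) * faceCountsProb t u v (i + 1) (j + 1) b +
      ((i - b : ℕ) : ℝ≥0∞) * faceCountsProb t u v i (j + 1) b +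
      ((j - b : ℕ) : ℝ≥0∞) * faceCountsProb t u v (i + 1) j b +
      (b : ℝ≥0∞) * faceCountsProb t u v i j b := by
  unfold faceCountsProb
  rw [mul_expect_randomApollonianNetwork_succ]
  simp only [← PMF.expect_const_mul, ← PMF.expect_add]
  refine PMF.expect_mono _ fun N hN => ?_
  have hN := isApollonian_of_mem_support hN
  have := card_faces_hasFaceCounts_subdivide_le hN huv (by rwa [hN.order_eq])
    (by rwa [hN.order_eq]) i j b
  rw [Finset.card_filter] at this
  exact_mod_cast this

/-- The recursion turns the factor 2t+1 at time t+1 into 2t−1 at time t, so 2t−1 times the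
probability stays below a fixed multiple of the weight. At the base, a possible triple has weight at
least 1 and probability at most 1. -/
lemma faceCountsProb_le {u v T b : ℕ} (huv : u ≠ v) (hu1 : 1 ≤ u) (hv1 : 1 ≤ v) (hT : 1 ≤ T)
    (hu : u ≤ T + 3) (hv : v ≤ T + 3) (hb : b + 3 ≤ 2 * T + 1) {t : ℕ} (ht : T ≤ t) (i j : ℕ) :
    ((2 * t - 1 : ℕ) : ℝ≥0∞) * faceCountsProb t u v i j b ≤
      ((localWeight (2 * t + 1) i j b * (2 * T - 1) : ℕ) : ℝ≥0∞) := by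
  induction t, ht using Nat.le_induction generalizing i j with
  | base =>
    rcases Nat.eq_zero_or_pos (localWeight (2 * T + 1) i j b) with h | h
    · rw [faceCountsProb_eq_zero hT hu1 hv1 hu hv h, mul_zero]
      exact zero_le
    · calc _ ≤ ((2 * T - 1 : ℕ) : ℝ≥0∞) * 1 := by gcongr; exact faceCountsProb_le_one _ _ _ _ _ _
        _ ≤ _ := by
          rw [mul_one]
          exact Nat.cast_le.2 (Nat.le_mul_of_pos_left _ h)
  | succ t ht ih =>
    rcases Nat.eq_zero_or_pos (localWeight (2 * (t + 1) + 1) i j b) with h | h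
    · rw [faceCountsProb_eq_zero (by omega) hu1 hv1 (by omega) (by omega) h, mul_zero]
      exact zero_le
    have hij : 2 ≤ i ∧ 2 ≤ j := by
      unfold localWeight at h
      split_ifs at h <;> omega
    obtain ⟨i, rfl⟩ := Nat.exists_eq_add_of_le' (show 1 ≤ i by omega)
    obtain ⟨j, rfl⟩ := Nat.exists_eq_add_of_le' (show 1 ≤ j by omega)
    have hstep := mul_faceCountsProb_succ_le (t := t) huv (by omega) (by omega) i j b
    have hrec := localWeight_recursion (2 * t + 1) i j b (by omega)
    have hne : ((2 * t - 1 : ℕ) : ℝ≥0∞) ≠ 0 := by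
      rw [Nat.cast_ne_zero]
      omega
    rw [← ENNReal.mul_le_mul_iff_right hne (ENNReal.natCast_ne_top _),
      show 2 * (t + 1) - 1 = 2 * t + 1 by omega]
    refine (mul_le_mul_right hstep _).trans ?_
    simp only [mul_add, mul_left_comm ((2 * t - 1 : ℕ) : ℝ≥0∞) _ (faceCountsProb _ _ _ _ _ _)]
    refine (add_le_add (add_le_add (add_le_add (mul_le_mul_right (ih _ _) _)
      (mul_le_mul_right (ih _ _) _)) (mul_le_mul_right (ih _ _) _))
      (mul_le_mul_right (ih _ _) _)).trans ?_
    rw [← Nat.cast_mul, ← Nat.cast_mul, ← Nat.cast_mul, ← Nat.cast_mul, ← Nat.cast_mul,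
      ← Nat.cast_add, ← Nat.cast_add, ← Nat.cast_add]
    refine Nat.cast_le.2 ?_
    rw [show 2 * t + 2 * 1 + 1 = 2 * t + 1 + 2 by ring, ← mul_assoc, ← mul_assoc, ← mul_assoc,
      ← mul_assoc, ← mul_assoc, ← add_mul, ← add_mul, ← add_mul]
    exact Nat.mul_le_mul_right _ hrec

/-- By conservation, the count never exceeds the total number of faces at a time s when both
vertices exist. Hence only finitely many b have to be summed over. -/
lemma commonFaceCount_le {u v s : ℕ} (huv : u ≠ v) (hu : u ≤ s + 3) (hv : v ≤ s + 3) {t : ℕ}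
    (ht : s ≤ t) : ∀ N ∈ (randomApollonianNetwork t).support, N.commonFaceCount u v ≤ 2 * s + 1 := by
  induction t, ht using Nat.le_induction with
  | base =>
    intro N hN
    rw [← (isApollonian_of_mem_support hN).card_faces]
    exact Finset.card_filter_le _ _
  | succ t ht ih =>
    intro N hN
    obtain ⟨M, hM, F, hF, rfl⟩ := mem_support_randomApollonianNetwork_succ hN
    have hA := isApollonian_of_mem_support hM
    rw [commonFaceCount_subdivide hA hF huv (by rw [hA.order_eq]; omega)
      (by rw [hA.order_eq]; omega)]
    exact ih M hM

/-- The degrees of two given vertices take any two given values with probability `O(1 / t)`. -/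
lemma exists_toMeasureReal_degree_eq_le {u v : ℕ} (huv : u ≠ v) (hu1 : 1 ≤ u) (hv1 : 1 ≤ v) :
    ∃ C : ℝ, 0 ≤ C ∧ ∃ T : ℕ, ∀ t, T ≤ t → ∀ i j : ℕ,
      (randomApollonianNetwork t).toMeasure.real {N | N.degree u = i ∧ N.degree v = j} ≤ C / t := by
  -- Both vertices exist at time s, so b ≤ 2s+1; starting from T = s+2 ensures b+3 ≤ 2T+1.
  set s := u + v with hs
  refine ⟨(∑ _b ∈ Finset.range (2 * s + 2), (2 * (2 * (s + 2) - 1) : ℕ) : ℕ), by positivity,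
    s + 2, fun t ht i j => ?_⟩
  set i' := i - if u ≤ 3 then 1 else 0
  set j' := j - if v ≤ 3 then 1 else 0
  have ht1 : 1 ≤ t := by omega
  have hbound : ∀ b < 2 * s + 2, (randomApollonianNetwork t).toMeasure.real
      {N | HasFaceCounts u v i' j' b N} ≤ (2 * (2 * (s + 2) - 1) : ℕ) / (t : ℝ) := by
    intro b hb
    have h := faceCountsProb_le (T := s + 2) (b := b) huv hu1 hv1 (by omega) (by omega) (by omega)
      (by omega) ht i' j'
    have h := h.trans (Nat.cast_le.2 (Nat.mul_le_mul_right _ (localWeight_le_two _ _ _ _)))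
    have h := ENNReal.toReal_mono (ENNReal.natCast_ne_top _) h
    rw [faceCountsProb, ← PMF.toMeasure_eq_expect, ENNReal.toReal_mul, ENNReal.toReal_natCast,
      ENNReal.toReal_natCast] at h
    rw [le_div_iff₀ (by exact_mod_cast ht1), mul_comm]
    refine le_trans ?_ h
    gcongr
    · omega
    · exact le_refl _
  calc _ ≤ (randomApollonianNetwork t).toMeasure.real
        (⋃ b ∈ Finset.range (2 * s + 2), {N | HasFaceCounts u v i' j' b N}) := by
        refine ENNReal.toReal_mono (MeasureTheory.measure_ne_top _ _) ?_
        refine PMF.toMeasure_mono _ MeasurableSet.of_discrete fun N hN => ?_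
        obtain ⟨⟨hi, hj⟩, hN⟩ := hN
        have hA := isApollonian_of_mem_support hN
        have hB := commonFaceCount_le (s := s) huv (by omega) (by omega) (by omega : s ≤ t) N hN
        have h1 := hA.degree_eq u hu1 (by rw [hA.order_eq]; omega)
        have h2 := hA.degree_eq v hv1 (by rw [hA.order_eq]; omega)
        simp only [Set.mem_iUnion, Finset.mem_range]
        exact ⟨N.commonFaceCount u v, by omega, by omega, by omega, rfl⟩
    _ ≤ ∑ b ∈ Finset.range (2 * s + 2), (randomApollonianNetwork t).toMeasure.real
        {N | HasFaceCounts u v i' j' b N} := MeasureTheory.measureReal_biUnion_finset_le _ _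
    _ ≤ ∑ b ∈ Finset.range (2 * s + 2), (2 * (2 * (s + 2) - 1) : ℕ) / (t : ℝ) :=
        Finset.sum_le_sum fun b hb => hbound b (Finset.mem_range.1 hb)
    _ = _ := by
        rw [← Finset.sum_div, Nat.cast_sum]

/-! ### Anticoncentration of degrees at scale √t -/

lemma natCard_Icc_ceil_floor_le (a r : ℝ) (hr : 0 ≤ r) :
    ((Finset.Icc ⌈a - r⌉₊ ⌊a + r⌋₊).card : ℝ) ≤ 2 * r + 1 := by
  rw [Nat.card_Icc]
  have h1 : a - r ≤ ⌈a - r⌉₊ := Nat.le_ceil _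
  rcases le_total ⌈a - r⌉₊ (⌊a + r⌋₊ + 1) with h | h
  · rw [Nat.cast_sub h]
    push_cast
    rcases le_total 0 (a + r) with h0 | h0
    · have := Nat.floor_le h0
      linarith
    · rw [Nat.floor_of_nonpos h0]
      have : (0 : ℝ) ≤ ⌈a - r⌉₊ := Nat.cast_nonneg _
      push_cast
      linarith
  · rw [Nat.sub_eq_zero_of_le h]
    push_cast
    linarith

/-- The degree of `u` is unlikely to lie within `δ √t` of a value determined by the degree
of `v`. -/
lemma exists_toMeasureReal_abs_degree_sub_le {u v : ℕ} (huv : u ≠ v) (hu : 1 ≤ u) (hv : 1 ≤ v)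
    {η : ℝ} (hη : 0 < η) :
    ∃ δ : ℝ, 0 < δ ∧ ∀ᶠ t : ℕ in atTop, ∀ c : ℕ → ℝ,
      (randomApollonianNetwork t).toMeasure.real
        {N | |(N.degree u : ℝ) - c (N.degree v)| ≤ δ * √t} ≤ η := by
  obtain ⟨C, hC, T, hT⟩ := exists_toMeasureReal_degree_eq_le huv hu hv
  -- Cutoff for deg v: above M√t the fourth-moment tail costs at most η/2. The summand 1 gives M ≤
  -- M⁴.
  set M : ℝ := 1 + 466560 * 2 / η with hM
  have hM1 : 1 ≤ M := by
    have : 0 ≤ 466560 * 2 / η := by positivity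
    linarith
  have hM0 : 0 < M := by linarith
  have hMη : 466560 / M ^ 4 ≤ η / 2 := by
    have h1 : 466560 * 2 / η ≤ M := by linarith
    have h2 : M ≤ M ^ 4 := le_self_pow₀ hM1 (by norm_num)
    rw [div_le_iff₀ hη] at h1
    rw [div_le_iff₀ (by positivity)]
    nlinarith
  -- At most 2M√t values of deg v, each with at most 2δ√t+1 values of deg u, cost 4MδC + 2MC/√t.
  -- This δ makes the first term at most η/4; large t handles the rounding term.
  set δ : ℝ := η / (16 * M * (C + 1)) with hδ
  have hδ0 : 0 < δ := by positivity
  refine ⟨δ, hδ0, ?_⟩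
  have hsqrt : Tendsto (fun t : ℕ => √(t : ℝ)) atTop atTop :=
    Real.tendsto_sqrt_atTop.comp tendsto_natCast_atTop_atTop
  filter_upwards [eventually_ge_atTop T, eventually_ge_atTop 1,
    hsqrt.eventually_ge_atTop (8 * M * C / η)] with t htT ht1 hts c
  have ht0 : (1 : ℝ) ≤ t := by exact_mod_cast ht1
  have hs1 : 1 ≤ √(t : ℝ) := Real.one_le_sqrt.2 ht0
  have hs0 : 0 < √(t : ℝ) := by linarith
  have hss : √(t : ℝ) * √(t : ℝ) = t := Real.mul_self_sqrt (by linarith)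
  set μ := (randomApollonianNetwork t).toMeasure with hμ
  set W : ℕ → Finset ℕ := fun j => Finset.Icc ⌈c j - δ * √t⌉₊ ⌊c j + δ * √t⌋₊
  have hsub : {N : PlaneNetwork | |(N.degree u : ℝ) - c (N.degree v)| ≤ δ * √t} ⊆
      {N | M * √t ≤ N.degree v} ∪ ⋃ j ∈ Finset.range ⌈M * √t⌉₊, ⋃ i ∈ W j,
        {N | N.degree u = i ∧ N.degree v = j} := by
    intro N hN
    have hN : |(N.degree u : ℝ) - c (N.degree v)| ≤ δ * √t := hN
    rw [abs_le] at hN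
    rcases le_or_gt (M * √t) (N.degree v) with h | h
    · exact Or.inl h
    · right
      simp only [Set.mem_iUnion, Finset.mem_range]
      refine ⟨N.degree v, Nat.lt_ceil.2 h, N.degree u, Finset.mem_Icc.2 ⟨?_, ?_⟩, rfl, rfl⟩
      · exact Nat.ceil_le.2 (by linarith)
      · exact Nat.le_floor (by linarith)
  have h1 : μ.real {N | M * √t ≤ N.degree v} ≤ η / 2 := by
    refine (toMeasureReal_le_degree_le ht1 hv (by positivity)).trans ?_
    have hv1 : ((v : ℝ) ^ 2)⁻¹ ≤ 1 := by
      refine inv_le_one_of_one_le₀ (one_le_pow₀ ?_)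
      exact_mod_cast hv
    have h4 : (M * √(t : ℝ)) ^ 4 = M ^ 4 * (t : ℝ) ^ 2 := by
      calc (M * √(t : ℝ)) ^ 4 = M ^ 4 * (√(t : ℝ) * √(t : ℝ)) ^ 2 := by ring
        _ = _ := by rw [hss]
    calc _ ≤ 466560 * (t : ℝ) ^ 2 / (M * √t) ^ 4 * 1 := by gcongr
      _ = 466560 / M ^ 4 := by rw [h4]; field_simp
      _ ≤ _ := hMη
  have h2 : μ.real (⋃ j ∈ Finset.range ⌈M * √t⌉₊, ⋃ i ∈ W j,
      {N | N.degree u = i ∧ N.degree v = j}) ≤ (2 * M * √t) * ((2 * (δ * √t) + 1) * (C / t)) := by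
    calc _ ≤ ∑ j ∈ Finset.range ⌈M * √t⌉₊, μ.real (⋃ i ∈ W j,
          {N | N.degree u = i ∧ N.degree v = j}) := MeasureTheory.measureReal_biUnion_finset_le _ _
      _ ≤ ∑ j ∈ Finset.range ⌈M * √t⌉₊, (2 * (δ * √t) + 1) * (C / t) := by
          refine Finset.sum_le_sum fun j _ => ?_
          calc _ ≤ ∑ i ∈ W j, μ.real {N | N.degree u = i ∧ N.degree v = j} :=
                MeasureTheory.measureReal_biUnion_finset_le _ _
            _ ≤ ∑ i ∈ W j, C / t := Finset.sum_le_sum fun i _ => hT t htT i j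
            _ = (W j).card * (C / t) := by rw [Finset.sum_const, nsmul_eq_mul]
            _ ≤ _ := by
              gcongr
              exact natCard_Icc_ceil_floor_le _ _ (by positivity)
      _ = (⌈M * √t⌉₊ : ℝ) * ((2 * (δ * √t) + 1) * (C / t)) := by
          rw [Finset.sum_const, nsmul_eq_mul, Finset.card_range]
      _ ≤ _ := by
          gcongr
          have := Nat.ceil_lt_add_one (show 0 ≤ M * √(t : ℝ) by positivity)
          nlinarith
  have h3 : (2 * M * √t) * ((2 * (δ * √t) + 1) * (C / t)) ≤ η / 2 := by
    have e : (2 * M * √t) * ((2 * (δ * √t) + 1) * (C / t)) =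
        4 * M * δ * C + 2 * M * C / √t := by
      generalize √(t : ℝ) = s at hss hs0
      rw [← hss]
      field_simp
      ring
    have e1 : 4 * M * δ * C ≤ η / 4 := by
      calc 4 * M * δ * C ≤ 4 * M * δ * (C + 1) := by gcongr; linarith
        _ = η / 4 := by rw [hδ]; field_simp; norm_num
    have e2 : 2 * M * C / √t ≤ η / 4 := by
      rw [div_le_iff₀ hη] at hts
      rw [div_le_iff₀ hs0]
      linarith
    rw [e]
    linarith
  have := (MeasureTheory.measureReal_mono hsub).trans
    (MeasureTheory.measureReal_union_le (μ := μ) _ _)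
  linarith

/-! ### Ranking vertices by degree -/

namespace PlaneNetwork

variable {N : PlaneNetwork}

/-- The vertices can be listed by non-increasing degree. -/
lemma exists_degree_ranking (N : PlaneNetwork) :
    ∃ w : ℕ → ℕ, Set.InjOn w (Set.Icc 1 N.order) ∧
      (∀ v, 1 ≤ v → v ≤ N.order → ∃ i, 1 ≤ i ∧ i ≤ N.order ∧ w i = v) ∧
      (∀ i, 1 ≤ i → i ≤ N.order → 1 ≤ w i ∧ N.highestDegree i = N.degree (w i)) ∧
      ∀ i j, 1 ≤ i → i ≤ j → j ≤ N.order → N.highestDegree j ≤ N.highestDegree i := by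
  set r : ℕ → ℕ → Prop := fun a b => N.degree a ≥ N.degree b with hr
  have : Std.Total r := ⟨fun a b => le_total _ _⟩
  have : IsTrans ℕ r := ⟨fun a b c hab hbc => le_trans hbc hab⟩
  set L := (Finset.Icc 1 N.order).toList.insertionSort r with hL
  have hperm : L.Perm (Finset.Icc 1 N.order).toList := List.perm_insertionSort _ _
  have hlen : L.length = N.order := by
    rw [hperm.length_eq, Finset.length_toList, Nat.card_Icc]
    omega
  have hnd : L.Nodup := hperm.nodup_iff.2 (Finset.nodup_toList _)
  have hmem : ∀ v, v ∈ L ↔ 1 ≤ v ∧ v ≤ N.order := fun v => by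
    rw [hperm.mem_iff, Finset.mem_toList, Finset.mem_Icc]
  have hsorted : (L.map N.degree).Pairwise (· ≥ ·) :=
    List.pairwise_map.2 (List.pairwise_insertionSort r _)
  have hmap : N.degreeList = L.map N.degree := by
    refine List.Perm.eq_of_pairwise (le := (· ≥ ·)) (fun a b _ _ h1 h2 => le_antisymm h2 h1)
      (Multiset.pairwise_sort _ _) hsorted ?_
    rw [← Multiset.coe_eq_coe, degreeList, Multiset.sort_eq, ← Multiset.map_coe, Multiset.coe_eq_coe.2 hperm,
      Finset.coe_toList]
  have hget : ∀ i, 1 ≤ i → ∀ hi : i - 1 < L.length,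
      N.highestDegree i = N.degree L[i - 1] := by
    intro i _ hi
    rw [highestDegree, hmap, List.getD_eq_getElem _ _ (by simpa using hi), List.getElem_map]
  refine ⟨fun i => L.getD (i - 1) 0, ?_, ?_, ?_, ?_⟩
  · rintro i ⟨hi, hi'⟩ j ⟨hj, hj'⟩ hij
    have h1 : i - 1 < L.length := by omega
    have h2 : j - 1 < L.length := by omega
    simp only [List.getD_eq_getElem _ _ h1, List.getD_eq_getElem _ _ h2] at hij
    have := (hnd.getElem_inj_iff).1 hij
    omega
  · intro v hv hv'
    obtain ⟨n, hn, rfl⟩ := List.getElem_of_mem ((hmem v).2 ⟨hv, hv'⟩)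
    refine ⟨n + 1, by omega, by omega, ?_⟩
    simp [hn]
  · intro i hi hi'
    have h1 : i - 1 < L.length := by omega
    simp only [List.getD_eq_getElem _ _ h1]
    exact ⟨((hmem _).1 (List.getElem_mem h1)).1, hget i hi h1⟩
  · intro i j hi hij hj
    rcases hij.eq_or_lt with rfl | hlt
    · exact le_rfl
    · have := List.pairwise_iff_getElem.1 hsorted (i - 1) (j - 1) (by simp; omega)
        (by simp; omega) (by omega)
      rw [List.getElem_map, List.getElem_map] at this
      rw [hget i hi (by omega), hget j (by omega) (by omega)]
      exact this

/-- If `k` vertices have degree at least `θ` and the degrees that are at least `θ` are more than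
`γ` apart, then so are the `k` highest degrees. -/
lemma highestDegree_separated {k : ℕ} (hk : k ≤ N.order) {θ γ : ℝ}
    (hlarge : ∀ v, 1 ≤ v → v ≤ k → θ ≤ N.degree v)
    (hsep : ∀ u v, 1 ≤ u → 1 ≤ v → u ≠ v → θ ≤ N.degree u → θ ≤ N.degree v →
      γ < |(N.degree u : ℝ) - N.degree v|) :
    (∀ i, 1 ≤ i → i ≤ k → θ ≤ N.highestDegree i) ∧
      ∀ i, 2 ≤ i → i ≤ k → (N.highestDegree i : ℝ) ≤ N.highestDegree (i - 1) - γ := by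
  obtain ⟨w, hinj, hsurj, hw, hanti⟩ := N.exists_degree_ranking
  have h1 : ∀ i, 1 ≤ i → i ≤ k → θ ≤ N.highestDegree i := by
    intro i hi hik
    by_contra! hlt
    -- Pigeonhole: if rank i falls below θ, the k large vertices must all occupy the i−1 < k ranks
    -- before it.
    have hsub : Finset.Icc 1 k ⊆ (Finset.Ico 1 i).image w := by
      intro v hv
      rw [Finset.mem_Icc] at hv
      obtain ⟨j, hj, hj', rfl⟩ := hsurj v hv.1 (by omega)
      refine Finset.mem_image_of_mem _ (Finset.mem_Ico.2 ⟨hj, ?_⟩)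
      by_contra! hij
      have ha : (N.highestDegree j : ℝ) ≤ N.highestDegree i := by
        exact_mod_cast hanti i j hi hij hj'
      have hb := hlarge _ hv.1 hv.2
      rw [← (hw j hj hj').2] at hb
      linarith
    have := (Finset.card_le_card hsub).trans Finset.card_image_le
    rw [Nat.card_Icc, Nat.card_Ico] at this
    omega
  refine ⟨h1, fun i hi hik => ?_⟩
  have ha : (N.highestDegree i : ℝ) ≤ N.highestDegree (i - 1) := by
    exact_mod_cast hanti (i - 1) i (by omega) (by omega) (by omega)
  have hi1 := h1 i (by omega) hik
  have hi2 := h1 (i - 1) (by omega) (by omega)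
  have hwi := hw i (by omega) (by omega)
  have hwi' := hw (i - 1) (by omega) (by omega)
  have hne : w (i - 1) ≠ w i := fun h => by
    have := hinj ⟨by omega, by omega⟩ ⟨by omega, by omega⟩ h
    omega
  rw [hwi.2] at hi1 ha ⊢
  rw [hwi'.2] at hi2 ha ⊢
  have := hsep _ _ hwi'.1 hwi.1 hne hi2 hi1
  rw [abs_of_nonneg (by linarith)] at this
  linarith

end PlaneNetwork

/-! ### Combining the estimates -/

lemma exists_toMeasureReal_exists_abs_degree_sub_le (s : Finset (ℕ × ℕ))
    (hs : ∀ p ∈ s, p.1 ≠ p.2 ∧ 1 ≤ p.1 ∧ 1 ≤ p.2) {η : ℝ} (hη : 0 < η) :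
    ∃ δ : ℝ, 0 < δ ∧ ∀ᶠ t : ℕ in atTop, ∀ c : ℕ → ℝ,
      (randomApollonianNetwork t).toMeasure.real
        {N | ∃ p ∈ s, |(N.degree p.1 : ℝ) - c (N.degree p.2)| ≤ δ * √t} ≤ η := by
  induction s using Finset.induction_on generalizing η with
  | empty => exact ⟨1, one_pos, Eventually.of_forall fun t c => by simpa using hη.le⟩
  | insert p s _ ih =>
    obtain ⟨δ₁, hδ₁, h₁⟩ := ih (fun q hq => hs q (Finset.mem_insert_of_mem hq)) (half_pos hη)
    obtain ⟨hne, h1, h2⟩ := hs p (Finset.mem_insert_self _ _)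
    obtain ⟨δ₂, hδ₂, h₂⟩ := exists_toMeasureReal_abs_degree_sub_le hne h1 h2 (half_pos hη)
    refine ⟨min δ₁ δ₂, lt_min hδ₁ hδ₂, ?_⟩
    filter_upwards [h₁, h₂] with t h₁ h₂ c
    have hsub : {N : PlaneNetwork | ∃ q ∈ insert p s,
        |(N.degree q.1 : ℝ) - c (N.degree q.2)| ≤ min δ₁ δ₂ * √t} ⊆
        {N | ∃ q ∈ s, |(N.degree q.1 : ℝ) - c (N.degree q.2)| ≤ δ₁ * √t} ∪
        {N | |(N.degree p.1 : ℝ) - c (N.degree p.2)| ≤ δ₂ * √t} := by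
      rintro N ⟨q, hq, hN⟩
      rcases Finset.mem_insert.1 hq with rfl | hq
      · exact Or.inr (hN.trans (by gcongr; exact min_le_right _ _))
      · exact Or.inl ⟨q, hq, hN.trans (by gcongr; exact min_le_left _ _)⟩
    have := (MeasureTheory.measureReal_mono hsub).trans
      (MeasureTheory.measureReal_union_le (μ := (randomApollonianNetwork t).toMeasure) _ _)
    linarith [h₁ c, h₂ c]

lemma toMeasureReal_exists_mul_sqrt_le_degree_le {t : ℕ} (ht : 1 ≤ t) (K : ℕ) {y : ℝ}
    (hy : 0 < y) :
    (randomApollonianNetwork t).toMeasure.real {N | ∃ v, K < v ∧ y * √t ≤ N.degree v} ≤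
      466560 / y ^ 4 * (2 / (K + 1)) := by
  have ht0 : (0 : ℝ) < t := by exact_mod_cast ht
  refine (toMeasureReal_exists_le_degree_le ht K (by positivity)).trans_eq ?_
  have h4 : (y * √(t : ℝ)) ^ 4 = y ^ 4 * (t : ℝ) ^ 2 := by
    calc (y * √(t : ℝ)) ^ 4 = y ^ 4 * (√(t : ℝ) * √(t : ℝ)) ^ 2 := by ring
      _ = _ := by rw [Real.mul_self_sqrt ht0.le]
  rw [h4]
  field_simp

theorem theorem1 (k : ℕ) (hk : 1 ≤ k) (f : ℕ → ℝ) (hf : Tendsto f atTop atTop) :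
    Tendsto (fun t : ℕ => (randomApollonianNetwork t).toMeasure
      {N : PlaneNetwork |
        (√(t : ℝ) / f t ≤ (N.highestDegree 1 : ℝ) ∧
          (N.highestDegree 1 : ℝ) ≤ √(t : ℝ) * f t) ∧
        ∀ i : ℕ, 2 ≤ i → i ≤ k →
          √(t : ℝ) / f t ≤ (N.highestDegree i : ℝ) ∧
          (N.highestDegree i : ℝ) ≤ (N.highestDegree (i - 1) : ℝ) - √(t : ℝ) / f t})
      atTop (𝓝 1) := by
  set E : ℕ → Set PlaneNetwork := fun t => {N : PlaneNetwork |
        (√(t : ℝ) / f t ≤ (N.highestDegree 1 : ℝ) ∧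
          (N.highestDegree 1 : ℝ) ≤ √(t : ℝ) * f t) ∧
        ∀ i : ℕ, 2 ≤ i → i ≤ k →
          √(t : ℝ) / f t ≤ (N.highestDegree i : ℝ) ∧
          (N.highestDegree i : ℝ) ≤ (N.highestDegree (i - 1) : ℝ) - √(t : ℝ) / f t} with hE
  suffices h : Tendsto (fun t => (randomApollonianNetwork t).toMeasure.real (E t)ᶜ) atTop (𝓝 0) by
    have h1 : Tendsto (fun t => ENNReal.ofReal (1 - (randomApollonianNetwork t).toMeasure.real
        (E t)ᶜ)) atTop (𝓝 (ENNReal.ofReal (1 - 0))) :=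
      ENNReal.tendsto_ofReal (tendsto_const_nhds.sub h)
    rw [sub_zero, ENNReal.ofReal_one] at h1
    refine h1.congr fun t => ?_
    rw [← MeasureTheory.probReal_compl_eq_one_sub MeasurableSet.of_discrete, compl_compl,
      MeasureTheory.ofReal_measureReal]
  suffices h : ∀ η : ℝ, 0 < η →
      ∀ᶠ t in atTop, (randomApollonianNetwork t).toMeasure.real (E t)ᶜ ≤ η by
    rw [Metric.tendsto_atTop']
    intro η hη
    obtain ⟨T, hT⟩ := eventually_atTop.1 (h (η / 2) (half_pos hη))
    refine ⟨T, fun t ht => ?_⟩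
    rw [Real.dist_eq, sub_zero, abs_of_nonneg MeasureTheory.measureReal_nonneg]
    linarith [hT t ht.le]
  intro η hη
  have hη4 : 0 < η / 4 := by positivity
  -- This is later used with `c = 0`, which bounds deg u from below; the partner u+1 serves only to
  -- supply a second vertex.
  obtain ⟨ε, hε, hlow⟩ := exists_toMeasureReal_exists_abs_degree_sub_le
    ((Finset.Icc 1 k).image fun u => (u, u + 1)) (by
      intro p hp
      obtain ⟨u, hu, rfl⟩ := Finset.mem_image.1 hp
      rw [Finset.mem_Icc] at hu
      dsimp only
      omega) hη4
  obtain ⟨K, hK⟩ := exists_nat_ge (466560 / ε ^ 4 * 2 / (η / 4))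
  have hK' : 466560 / ε ^ 4 * (2 / ((K : ℝ) + 1)) ≤ η / 4 := by
    rw [div_le_iff₀ hη4] at hK
    rw [← mul_div_assoc, div_le_iff₀ (by positivity)]
    linarith
  obtain ⟨δ, hδ, hgap⟩ := exists_toMeasureReal_exists_abs_degree_sub_le
    (Finset.Icc 1 K).offDiag (by
      intro p hp
      simp only [Finset.mem_offDiag, Finset.mem_Icc] at hp
      omega) hη4
  filter_upwards [hlow, hgap, eventually_ge_atTop 1, eventually_ge_atTop k,
    hf.eventually_ge_atTop 1, hf.eventually_ge_atTop (466560 * 2 / (η / 4)),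
    hf.eventually_ge_atTop (1 / ε), hf.eventually_ge_atTop (1 / δ)]
    with t hlow hgap ht1 htk hf1 hfη hfε hfδ
  have hlow := hlow fun _ => 0
  have hgap := hgap fun d => d
  have hf0 : 0 < f t := by linarith
  have hfar := toMeasureReal_exists_mul_sqrt_le_degree_le ht1 K hε
  -- With K = 0 the union covers every vertex, which controls the maximum degree.
  have htop := toMeasureReal_exists_mul_sqrt_le_degree_le ht1 0 hf0
  have htop' : 466560 / f t ^ 4 * (2 / (((0 : ℕ) : ℝ) + 1)) ≤ η / 4 := by
    have h2 : f t ≤ f t ^ 4 := le_self_pow₀ hf1 (by norm_num)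
    rw [div_le_iff₀ hη4] at hfη
    rw [div_mul_eq_mul_div, div_le_iff₀ (by positivity)]
    norm_num
    nlinarith
  have hγε : √(t : ℝ) / f t ≤ ε * √t := by
    rw [div_le_iff₀ hε] at hfε
    rw [div_le_iff₀ hf0]
    nlinarith [Real.sqrt_nonneg (t : ℝ)]
  have hγδ : √(t : ℝ) / f t ≤ δ * √t := by
    rw [div_le_iff₀ hδ] at hfδ
    rw [div_le_iff₀ hf0]
    nlinarith [Real.sqrt_nonneg (t : ℝ)]
  have hbad : (randomApollonianNetwork t).toMeasure.real (E t)ᶜ ≤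
      (randomApollonianNetwork t).toMeasure.real
        {N | N ∈ (({N : PlaneNetwork | ∃ v, 0 < v ∧ f t * √t ≤ N.degree v} ∪
          {N | ∃ p ∈ (Finset.Icc 1 k).image fun u => (u, u + 1),
            |(N.degree p.1 : ℝ) - 0| ≤ ε * √t}) ∪
          {N | ∃ v, K < v ∧ ε * √t ≤ N.degree v}) ∪
          {N | ∃ p ∈ (Finset.Icc 1 K).offDiag,
            |(N.degree p.1 : ℝ) - N.degree p.2| ≤ δ * √t}} := by
    refine toMeasureReal_mono (P := fun N => N ∈ (E t)ᶜ) fun N hN hNE => ?_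
    by_contra hgood
    simp only [Set.mem_union, Set.mem_ofPred_eq, not_or, not_exists, not_and, not_le] at hgood
    obtain ⟨⟨⟨g1, g2⟩, g3⟩, g4⟩ := hgood
    refine hNE ?_
    have hko : k ≤ N.order := by rw [hN.order_eq]; omega
    obtain ⟨hl, hs⟩ := highestDegree_separated (N := N) (k := k) (θ := ε * √t) (γ := √t / f t) hko
      (by
        intro v hv hvk
        have := g2 (v, v + 1) (Finset.mem_image_of_mem _ (Finset.mem_Icc.2 ⟨hv, hvk⟩))
        rw [sub_zero, Nat.abs_cast] at this
        exact this.le)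
      (by
        intro u v hu hv huv hdu hdv
        have huK : u ≤ K := by
          by_contra! h
          linarith [g3 u h]
        have hvK : v ≤ K := by
          by_contra! h
          linarith [g3 v h]
        exact hγδ.trans_lt (g4 (u, v) (by
          simp only [Finset.mem_offDiag, Finset.mem_Icc]
          omega)))
    obtain ⟨w, -, -, hw, -⟩ := N.exists_degree_ranking
    obtain ⟨hw1, hw2⟩ := hw 1 le_rfl (by omega)
    refine ⟨⟨hγε.trans (hl 1 le_rfl hk), ?_⟩, fun i hi hik =>
      ⟨hγε.trans (hl i (by omega) hik), hs i hi hik⟩⟩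
    rw [hw2, mul_comm]
    exact (g1 _ hw1).le
  refine hbad.trans ((MeasureTheory.measureReal_union_le _ _).trans ?_)
  have u1 := MeasureTheory.measureReal_union_le (μ := (randomApollonianNetwork t).toMeasure)
    ({N : PlaneNetwork | ∃ v, 0 < v ∧ f t * √t ≤ N.degree v} ∪
          {N | ∃ p ∈ (Finset.Icc 1 k).image fun u => (u, u + 1),
            |(N.degree p.1 : ℝ) - 0| ≤ ε * √t}) {N | ∃ v, K < v ∧ ε * √t ≤ N.degree v}
  have u2 := MeasureTheory.measureReal_union_le (μ := (randomApollonianNetwork t).toMeasure)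
    {N : PlaneNetwork | ∃ v, 0 < v ∧ f t * √t ≤ N.degree v}
          {N | ∃ p ∈ (Finset.Icc 1 k).image fun u => (u, u + 1),
            |(N.degree p.1 : ℝ) - 0| ≤ ε * √t}
  linarith
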